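/- Let $\mathbb{D}\subset\mathbb{C}$ be the open unit disk and let $\Omega\subset\mathbb{C}^2$ be a bounded pseudoconvex complete Reinhardt domain with smooth ($C^\infty$) boundary $b\Omega$. Let $\phi\in C(\overline{\Omega})$ be such that $\phi\circ f$ is holomorphic on $\mathbb{D}$ for every holomorphic $f:\mathbb{D}\to\mathbb{C}^2$ with $f(\mathbb{D})\subset b\Omega$. By a continuous family of non-trivial analytic disks in $b\Omega$ we mean a set of the form \[\Gamma=\{(e^{i\theta}F_1(\zeta),e^{i\theta}F_2(\zeta)):\theta\in[0,2\pi],\ \zeta\in\mathbb{D}\},\] where $F=(F_1,F_2):\overline{\mathbb{D}}\to\mathbb{C}^2$ is continuous, holomorphic on $\mathbb{D}$ and non-constant, and $F(\mathbb{D})\subset b\Omega$. Let $\Gamma$ be such a family, and suppose that $\overline{\Gamma}\cap\overline{\Gamma'}=\emptyset$ for every continuous family $\Gamma'$ of non-trivial analytic disks in $b\Omega$ that is not contained in $\Gamma$. Then there is a sequence $(\psi_n)_{n\in\mathbb{N}}$ in $C^\infty(\overline{\Omega})$, consisting of restrictions to $\overline{\Omega}$ of $C^\infty$ functions on $\mathbb{C}^2$,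 such that 1. $\psi_n\to\phi$ uniformly on $\overline{\Gamma}$ as $n\to\infty$; 2. for every $n$, $\psi_n\circ f$ is holomorphic on $\mathbb{D}$ for every holomorphic $f:\mathbb{D}\to\mathbb{C}^2$ with $f(\mathbb{D})\subset\Gamma$. -/

import Mathlib

open scoped ContDiff

/-- `u` is a continuous plurisubharmonic function on the open set `Ω ⊆ ℂ²`: it satisfies the
sub-mean value inequality on the boundary circle of every closed affine disk contained in `Ω`. -/
def IsContPlurisubharmonicOn (u : ℂ × ℂ → ℝ) (Ω : Set (ℂ × ℂ)) : Prop :=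
  ContinuousOn u Ω ∧
    ∀ a b : ℂ × ℂ, (∀ ζ ∈ Metric.closedBall (0 : ℂ) 1, a + ζ • b ∈ Ω) →
      u a ≤ Real.circleAverage (fun ζ : ℂ => u (a + ζ • b)) 0 1

/-- `Ω` is pseudoconvex: it has a continuous plurisubharmonic exhaustion function. -/
def IsPseudoconvex (Ω : Set (ℂ × ℂ)) : Prop :=
  ∃ u : ℂ × ℂ → ℝ, IsContPlurisubharmonicOn u Ω ∧ ∀ c : ℝ, IsCompact {z ∈ Ω | u z ≤ c}

/-- `Ω` is a complete Reinhardt set (centred at the origin). -/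
def IsCompleteReinhardt (Ω : Set (ℂ × ℂ)) : Prop :=
  ∀ z ∈ Ω, ∀ w : ℂ × ℂ, ‖w.1‖ ≤ ‖z.1‖ → ‖w.2‖ ≤ ‖z.2‖ → w ∈ Ω

/-- `Ω` has a (`C^∞`-)smooth boundary: near each boundary point it is the negativity set of a
smooth real function whose differential does not vanish at that point. -/
def HasSmoothBoundary (Ω : Set (ℂ × ℂ)) : Prop :=
  ∀ p ∈ frontier Ω, ∃ U : Set (ℂ × ℂ), IsOpen U ∧ p ∈ U ∧ ∃ ρ : ℂ × ℂ → ℝ,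
    ContDiffOn ℝ ∞ ρ U ∧ fderiv ℝ ρ p ≠ 0 ∧ Ω ∩ U = {z ∈ U | ρ z < 0}

/-- Bounded pseudoconvex complete Reinhardt domains in `ℂ²` with smooth boundary. -/
structure IsSmoothPseudoconvexReinhardtDomain (Ω : Set (ℂ × ℂ)) : Prop where
  isOpen : IsOpen Ω
  isConnected : IsConnected Ω
  isBounded : Bornology.IsBounded Ω
  pseudoconvex : IsPseudoconvex Ω
  completeReinhardt : IsCompleteReinhardt Ω
  smoothBoundary : HasSmoothBoundary Ω

/-- `φ` is holomorphic along all holomorphic maps from the open unit disk into `S`. -/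
def HolomorphicAlongDisks (φ : ℂ × ℂ → ℂ) (S : Set (ℂ × ℂ)) : Prop :=
  ∀ f : ℂ → ℂ × ℂ, DifferentiableOn ℂ f (Metric.ball 0 1) →
    Set.MapsTo f (Metric.ball 0 1) S → DifferentiableOn ℂ (φ ∘ f) (Metric.ball 0 1)

/-- `F` parametrizes a non-trivial analytic disk in the boundary of `Ω`: it is holomorphic on the
open unit disk, continuous up to the closed unit disk, not constant, and `F(𝔻) ⊆ bΩ`. -/
structure IsNontrivialBoundaryDisk (Ω : Set (ℂ × ℂ)) (F : ℂ → ℂ × ℂ) : Prop where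
  holomorphic : DifferentiableOn ℂ F (Metric.ball 0 1)
  continuous_closedBall : ContinuousOn F (Metric.closedBall 0 1)
  nonconstant : ¬ ∃ c : ℂ × ℂ, ∀ ζ ∈ Metric.ball (0 : ℂ) 1, F ζ = c
  mapsTo_frontier : Set.MapsTo F (Metric.ball 0 1) (frontier Ω)

/-- The union of the disks `e^{iθ} F(𝔻)`, `θ ∈ [0, 2π]`. -/
def diskFamily (F : ℂ → ℂ × ℂ) : Set (ℂ × ℂ) :=
  {p | ∃ θ ∈ Set.Icc (0 : ℝ) (2 * Real.pi), ∃ ζ ∈ Metric.ball (0 : ℂ) 1,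
    p = (Complex.exp (θ * Complex.I) * (F ζ).1, Complex.exp (θ * Complex.I) * (F ζ).2)}

/-- `Γ` is a continuous family of non-trivial analytic disks in the boundary of `Ω`. -/
def IsContinuousDiskFamily (Ω Γ : Set (ℂ × ℂ)) : Prop :=
  ∃ F : ℂ → ℂ × ℂ, IsNontrivialBoundaryDisk Ω F ∧ Γ = diskFamily F

/-- The closure of `Γ` is disjoint from the closure of any other continuous family of non-trivial
analytic disks in the boundary. Restricting the disks of `Γ` to smaller disks gives families
contained in `Γ`, so a family counts as another one if it is not contained in `Γ`. -/
def IsIsolatedDiskFamily (Ω Γ : Set (ℂ × ℂ)) : Prop :=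
  ∀ Γ' : Set (ℂ × ℂ), IsContinuousDiskFamily Ω Γ' → ¬ Γ' ⊆ Γ →
    Disjoint (closure Γ) (closure Γ')

/-! The torus acts on `closure Ω` and on `frontier Ω`, so a continuous extension of `φ` can be split
into weight components. Smoothing by an approximate identity on the torus and then by a
trigonometric polynomial shows that finite combinations of components approximate `φ` uniformly on
the compact orbit of the closed disk (`exists_sum_torusWeight_near`). It remains to treat one
component.

Rotated disks stay in the boundary, so a component is holomorphic along `F`
(`differentiableOn_torusWeight_comp`). A boundary disk lies in no complex line through the origin,
hence `F₁/F₂` is open where defined and non-zero, and the disk returns to the torus orbit of `F z`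
at points accumulating at `z` (`frequently_eq_torusRotate`). There homogeneity makes the component
equal to `c z₁^j z₂^k`; the identity theorem spreads this over the disk
(`exists_eq_const_mul_zpow`). By continuity of the component, a negative exponent with `c ≠ 0`
forces that coordinate of `F` to be non-zero on the closed disk (`const_eq_zero`), so the monomial
extends smoothly to `ℂ²` (`exists_contDiff_eqOn_torusWeight`). -/

open Set Filter Topology MeasureTheory UnitAddTorus

/-! ### Torus action and weight components -/

/-- The action of the two-dimensional torus on `ℂ²` by rotation of the coordinates. -/
noncomputable def torusRotate (t : UnitAddTorus (Fin 2)) (p : ℂ × ℂ) : ℂ × ℂ :=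
  ((t 0).toCircle * p.1, (t 1).toCircle * p.2)

lemma continuous_torusRotate :
    Continuous fun x : UnitAddTorus (Fin 2) × (ℂ × ℂ) => torusRotate x.1 x.2 := by
  have h : Continuous (AddCircle.toCircle (T := 1)) := AddCircle.continuous_toCircle
  unfold torusRotate
  fun_prop

lemma torusRotate_zero (p : ℂ × ℂ) : torusRotate 0 p = p := by
  simp [torusRotate]

lemma torusRotate_add (s t : UnitAddTorus (Fin 2)) (p : ℂ × ℂ) :
    torusRotate (s + t) p = torusRotate s (torusRotate t p) := by
  simp [torusRotate, AddCircle.toCircle_add, mul_assoc]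

lemma mFourier_apply_fin_two (n : Fin 2 → ℤ) (t : UnitAddTorus (Fin 2)) :
    mFourier n t = ((t 0).toCircle : ℂ) ^ n 0 * ((t 1).toCircle : ℂ) ^ n 1 := by
  simp [mFourier, fourier_apply, AddCircle.toCircle_zsmul]

/-- The component of `φ` of weight `-n` under the action of the torus. -/
noncomputable def torusWeight (n : Fin 2 → ℤ) (φ : ℂ × ℂ → ℂ) (p : ℂ × ℂ) : ℂ :=
  ∫ t : UnitAddTorus (Fin 2), mFourier n t * φ (torusRotate t p)

lemma continuous_comp_torusRotate {φ : ℂ × ℂ → ℂ} (hφ : Continuous φ) (p : ℂ × ℂ) :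
    Continuous fun t => φ (torusRotate t p) :=
  hφ.comp (continuous_torusRotate.comp (by fun_prop : Continuous fun t => (t, p)))

lemma integrable_of_continuous_torus {E : Type*} [NormedAddCommGroup E]
    {f : UnitAddTorus (Fin 2) → E} (hf : Continuous f) : Integrable f :=
  hf.integrable_of_hasCompactSupport (HasCompactSupport.of_compactSpace f)

lemma continuous_torusWeight {φ : ℂ × ℂ → ℂ} (hφ : Continuous φ) (n : Fin 2 → ℤ) :
    Continuous (torusWeight n φ) := by
  have h := continuous_parametric_integral_of_continuous (μ := (volume : Measure (UnitAddTorus (Fin 2))))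
    (f := fun (p : ℂ × ℂ) t => mFourier n t * φ (torusRotate t p))
    (((mFourier n).continuous.comp continuous_snd).mul
      (hφ.comp (continuous_torusRotate.comp continuous_swap))) isCompact_univ
  simp only [Measure.restrict_univ] at h
  exact h

/-- Invariance of Haar measure under translation by `s`. -/
lemma torusWeight_torusRotate (n : Fin 2 → ℤ) (φ : ℂ × ℂ → ℂ) (s : UnitAddTorus (Fin 2))
    (p : ℂ × ℂ) :
    torusWeight n φ (torusRotate s p) = mFourier (-n) s * torusWeight n φ p := by
  unfold torusWeight
  rw [← integral_const_mul, ← integral_add_right_eq_self (fun t => mFourier (-n) s * _) s]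
  congr 1 with t
  have h : mFourier (-n) s * mFourier n s = 1 := by
    rw [← mFourier_add, neg_add_cancel, mFourier_zero]; rfl
  have h2 : mFourier n (t + s) = mFourier n t * mFourier n s := by
    simp only [mFourier_apply_fin_two, Pi.add_apply, AddCircle.toCircle_add, Circle.coe_mul, mul_zpow]
    ring
  rw [torusRotate_add, h2]
  linear_combination (-mFourier n t * φ (torusRotate t (torusRotate s p))) * h

/-- Fejér-type argument: integrating a trigonometric polynomial against the orbit map gives a finite
combination of components, and such polynomials approximate a bump concentrated near `0`. -/
lemma exists_sum_torusWeight_near {φ : ℂ × ℂ → ℂ} (hφ : Continuous φ) {K : Set (ℂ × ℂ)}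
    (hK : IsCompact K) {ε : ℝ} (hε : 0 < ε) :
    ∃ a : (Fin 2 → ℤ) →₀ ℂ, ∀ p ∈ K, ‖φ p - a.sum fun n c => c * torusWeight n φ p‖ < ε := by
  have hjoint : Continuous fun x : UnitAddTorus (Fin 2) × (ℂ × ℂ) => φ (torusRotate x.1 x.2) :=
    hφ.comp continuous_torusRotate
  obtain ⟨M, hM⟩ : ∃ M : ℝ, ∀ t : UnitAddTorus (Fin 2), ∀ p ∈ K, ‖φ (torusRotate t p)‖ ≤ M := by
    obtain ⟨M, hM⟩ := ((isCompact_univ.prod hK).image hjoint).isBounded.exists_norm_le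
    exact ⟨M, fun t p hp => hM _ ⟨(t, p), ⟨mem_univ _, hp⟩, rfl⟩⟩
  have hU : ∀ᶠ t in 𝓝 (0 : UnitAddTorus (Fin 2)), ∀ p ∈ K, ‖φ p - φ (torusRotate t p)‖ < ε / 2 := by
    refine hK.eventually_forall_of_forall_eventually fun p _ => ?_
    have hc : Continuous fun x : UnitAddTorus (Fin 2) × (ℂ × ℂ) =>
        ‖φ x.2 - φ (torusRotate x.1 x.2)‖ := ((hφ.comp continuous_snd).sub hjoint).norm
    have := (hc.tendsto (0, p)).eventually (eventually_lt_nhds (b := ε / 2) ?_)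
    · exact this
    · simpa [torusRotate_zero] using hε
  obtain ⟨U, hU, hUo, h0U⟩ := eventually_nhds_iff.1 hU
  -- A Urysohn function supported in `U`; divided by its integral it becomes the averaging kernel
  -- `χ`.
  obtain ⟨f, hf0, hf1, hf⟩ := exists_continuous_zero_one_of_isClosed hUo.isClosed_compl
    (isClosed_singleton (x := (0 : UnitAddTorus (Fin 2)))) (by simpa using h0U)
  have hfpos : 0 < ∫ t, f t :=
    f.continuous.integral_pos_of_hasCompactSupport_nonneg_nonzero (.of_compactSpace f)
      (fun t => (hf t).1) (x := 0) (by rw [hf1 rfl]; simp)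
  set I := ∫ t, f t with hI
  let χ : C(UnitAddTorus (Fin 2), ℂ) := ⟨fun t => ((I⁻¹ * f t : ℝ) : ℂ), by fun_prop⟩
  have hnear : ∀ p ∈ K, ‖φ p - ∫ t, χ t * φ (torusRotate t p)‖ ≤ ε / 2 := by
    intro p hp
    have h1 : φ p = ∫ t, χ t * φ p := by
      have : ∫ t, χ t = 1 := by
        change ∫ t, ((I⁻¹ * f t : ℝ) : ℂ) = 1
        rw [integral_complex_ofReal, integral_const_mul, ← hI, inv_mul_cancel₀ hfpos.ne']
        simp
      rw [integral_mul_const, this, one_mul]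
    have hi : Continuous fun t => χ t * φ (torusRotate t p) :=
      χ.continuous.mul (continuous_comp_torusRotate hφ p)
    rw [h1, ← integral_sub (integrable_of_continuous_torus (by fun_prop))
      (integrable_of_continuous_torus hi)]
    have h2 : ∫ t, I⁻¹ * f t * (ε / 2) = ε / 2 := by
      rw [integral_mul_const, integral_const_mul, ← hI, inv_mul_cancel₀ hfpos.ne', one_mul]
    rw [← h2]
    refine norm_integral_le_of_norm_le (integrable_of_continuous_torus (by fun_prop))
      (.of_forall fun t => ?_)
    have hpos : 0 ≤ I⁻¹ * f t := mul_nonneg (inv_nonneg.2 hfpos.le) (hf t).1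
    rw [← mul_sub, norm_mul]
    by_cases ht : t ∈ U
    · gcongr
      · exact (Complex.norm_of_nonneg hpos).le
      · exact (hU t ht p hp).le
    · have : f t = 0 := hf0 ht
      simp [χ, this]
  have hspan : χ ∈ (Submodule.span ℂ (range <| mFourier (d := Fin 2))).topologicalClosure := by
    rw [span_mFourier_closure_eq_top]; trivial
  -- The torus has volume 1, so replacing `χ` by `P` costs at most `dist χ P * |M|`; the `+ 1` keeps
  -- the denominator positive.
  obtain ⟨P, hP, hPχ⟩ := Metric.mem_closure_iff.1 hspan (ε / 2 / (|M| + 1)) (by positivity)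
  obtain ⟨a, rfl⟩ := Finsupp.mem_span_range_iff_exists_finsupp.1 hP
  refine ⟨a, fun p hp => ?_⟩
  have hi := continuous_comp_torusRotate hφ p
  have hiC (g : C(UnitAddTorus (Fin 2), ℂ)) : Integrable fun t => g t * φ (torusRotate t p) :=
    integrable_of_continuous_torus (g.continuous.mul hi)
  set P := a.sum fun n c => c • mFourier (d := Fin 2) n with hPdef
  have hsum : (a.sum fun n c => c * torusWeight n φ p) = ∫ t, P t * φ (torusRotate t p) := by
    have : ∀ t, P t * φ (torusRotate t p) =
        ∑ n ∈ a.support, a n * (mFourier n t * φ (torusRotate t p)) := by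
      intro t
      rw [hPdef, Finsupp.sum, ContinuousMap.sum_apply, Finset.sum_mul]
      simp [mul_assoc]
    simp_rw [this]
    rw [integral_finsetSum _ fun n _ => (hiC _).const_mul _]
    simp_rw [integral_const_mul]
    rfl
  have hdiff : ‖(∫ t, χ t * φ (torusRotate t p)) - ∫ t, P t * φ (torusRotate t p)‖ < ε / 2 := by
    rw [← integral_sub (hiC _) (hiC _)]
    have : ‖∫ t, (χ t * φ (torusRotate t p) - P t * φ (torusRotate t p))‖ ≤ dist χ P * |M| := by
      refine (norm_integral_le_of_norm_le_const (C := dist χ P * |M|) (.of_forall fun t => ?_)).trans ?_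
      · rw [← sub_mul, norm_mul]
        gcongr
        · rw [← dist_eq_norm]; exact ContinuousMap.dist_apply_le_dist t
        · exact (hM t p hp).trans (le_abs_self M)
      · have hvol : (volume : Measure (UnitAddTorus (Fin 2))) univ = 1 := by
          change Measure.pi (fun _ => (volume : Measure (AddCircle (1 : ℝ)))) univ = 1
          simp [Measure.pi_univ]
        simp [Measure.real, hvol]
    refine this.trans_lt ?_
    calc dist χ P * |M| ≤ dist χ P * (|M| + 1) := by gcongr; linarith
      _ < _ := (lt_div_iff₀ (by positivity)).1 hPχ
  rw [hsum]
  calc _ ≤ ‖φ p - ∫ t, χ t * φ (torusRotate t p)‖ + _ := norm_sub_le_norm_sub_add_norm_sub _ _ _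
    _ < ε / 2 + ε / 2 := add_lt_add_of_le_of_lt (hnear p hp) hdiff
    _ = ε := add_halves ε

/-- Differentiation under the integral sign, with Cauchy's estimate as the dominating bound. -/
lemma differentiableOn_torusWeight_comp {φ : ℂ × ℂ → ℂ} (hφ : Continuous φ) {F : ℂ → ℂ × ℂ}
    {D : Set ℂ} (hD : IsOpen D) (hF : ContinuousOn F D)
    (hφF : ∀ t, DifferentiableOn ℂ (fun ζ => φ (torusRotate t (F ζ))) D) (n : Fin 2 → ℤ) :
    DifferentiableOn ℂ (fun ζ => torusWeight n φ (F ζ)) D := by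
  intro z hz
  obtain ⟨r, hr, hrD⟩ := Metric.nhds_basis_closedBall.mem_iff.1 (hD.mem_nhds hz)
  have hjoint : Continuous fun x : UnitAddTorus (Fin 2) × (ℂ × ℂ) => φ (torusRotate x.1 x.2) :=
    hφ.comp continuous_torusRotate
  obtain ⟨M, hM⟩ : ∃ M : ℝ, ∀ t : UnitAddTorus (Fin 2), ∀ ζ ∈ Metric.closedBall z r,
      ‖φ (torusRotate t (F ζ))‖ ≤ M := by
    have hK := (isCompact_closedBall z r).image_of_continuousOn (hF.mono hrD)
    obtain ⟨M, hM⟩ := ((isCompact_univ.prod hK).image hjoint).isBounded.exists_norm_le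
    exact ⟨M, fun t p hp => hM _ ⟨(t, _), ⟨mem_univ _, mem_image_of_mem F hp⟩, rfl⟩⟩
  have hd : ∀ t, ∀ x ∈ Metric.closedBall z r,
      HasDerivAt (fun ζ => φ (torusRotate t (F ζ))) (deriv (fun ζ => φ (torusRotate t (F ζ))) x) x :=
    fun t x hx => ((hφF t).differentiableAt (hD.mem_nhds (hrD hx))).hasDerivAt
  have hr2 : 0 < r / 2 := half_pos hr
  have hmeas (x : ℂ) : AEStronglyMeasurable (fun t => mFourier n t * φ (torusRotate t (F x))) :=
    ((mFourier n).continuous.mul (continuous_comp_torusRotate hφ (F x))).aestronglyMeasurable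
  have key := hasDerivAt_integral_of_dominated_loc_of_deriv_le
    (μ := (volume : Measure (UnitAddTorus (Fin 2)))) (x₀ := z) (s := Metric.ball z (r / 2))
    (F := fun ζ t => mFourier n t * φ (torusRotate t (F ζ)))
    (F' := fun ζ t => mFourier n t * deriv (fun ζ => φ (torusRotate t (F ζ))) ζ)
    (bound := fun _ => M / (r / 2)) (Metric.ball_mem_nhds z hr2) (.of_forall hmeas)
    (integrable_of_continuous_torus
      ((mFourier n).continuous.mul (continuous_comp_torusRotate hφ (F z)))) ?_ ?_
    (integrable_const _) ?_
  · exact key.2.differentiableAt.differentiableWithinAt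
  -- The derivative is measurable in `t` as a limit of difference quotients.
  · refine aestronglyMeasurable_of_tendsto_ae (𝓝[≠] z)
      (f := fun y t => (y - z)⁻¹ * (mFourier n t * φ (torusRotate t (F y)) -
        mFourier n t * φ (torusRotate t (F z)))) (fun y => ((hmeas y).sub (hmeas z)).const_mul _)
      (.of_forall fun t => ?_)
    exact (hasDerivAt_iff_tendsto_slope.1
      ((hd t z (Metric.mem_closedBall_self hr.le)).const_mul (mFourier n t)))
  · refine .of_forall fun t x hx => ?_
    have hsub : Metric.closedBall x (r / 2) ⊆ Metric.closedBall z r :=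
      Metric.closedBall_subset_closedBall' (by have := Metric.mem_ball.1 hx; linarith)
    rw [norm_mul]
    have h1 : ‖mFourier n t‖ ≤ 1 :=
      ((mFourier n).norm_coe_le_norm t).trans_eq mFourier_norm
    have h2 : ‖deriv (fun ζ => φ (torusRotate t (F ζ))) x‖ ≤ M / (r / 2) := by
      refine Complex.norm_deriv_le_of_forall_mem_sphere_norm_le hr2
        (DifferentiableOn.diffContOnCl ?_) fun w hw => hM t w (hsub (Metric.sphere_subset_closedBall hw))
      rw [closure_ball _ hr2.ne']
      exact (hφF t).mono (hsub.trans hrD)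
    nlinarith [norm_nonneg (deriv (fun ζ => φ (torusRotate t (F ζ))) x)]
  · refine .of_forall fun t x hx => (hd t x ?_).const_mul _
    exact Metric.ball_subset_closedBall (Metric.ball_subset_ball (by linarith) hx)

/-! ### Boundaries of complete Reinhardt domains -/

lemma norm_torusRotate_fst (t : UnitAddTorus (Fin 2)) (p : ℂ × ℂ) :
    ‖(torusRotate t p).1‖ = ‖p.1‖ := by
  rw [torusRotate, norm_mul, Circle.norm_coe, one_mul]

lemma norm_torusRotate_snd (t : UnitAddTorus (Fin 2)) (p : ℂ × ℂ) :
    ‖(torusRotate t p).2‖ = ‖p.2‖ := by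
  rw [torusRotate, norm_mul, Circle.norm_coe, one_mul]

lemma AddCircle.surjective_toCircle (c : Circle) : ∃ s : AddCircle (1 : ℝ), s.toCircle = c := by
  obtain ⟨s, hs⟩ := (AddCircle.homeomorphCircle (T := 1) one_ne_zero).surjective c
  exact ⟨s, by rw [← hs, AddCircle.homeomorphCircle_apply]⟩

/-- Points of `Ω` close enough to `p` dominate `l • p` in both coordinates. -/
lemma IsCompleteReinhardt.smul_mem {Ω : Set (ℂ × ℂ)} (hΩ : IsCompleteReinhardt Ω) {p : ℂ × ℂ}
    (hp : p ∈ closure Ω) {l : ℂ} (hl : ‖l‖ < 1) : l • p ∈ Ω := by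
  have aux (f : ℂ × ℂ → ℂ) (hf : Continuous f) : ∀ᶠ q in 𝓝 p, ‖l * f p‖ ≤ ‖f q‖ := by
    by_cases h : f p = 0
    · simp [h]
    · have h1 : ‖l * f p‖ < ‖f p‖ := by
        rw [norm_mul]
        exact mul_lt_of_lt_one_left (norm_pos_iff.2 h) hl
      exact ((hf.norm.tendsto p).eventually (eventually_gt_nhds h1)).mono fun _ => le_of_lt
  obtain ⟨q, hq, hqΩ⟩ := mem_closure_iff_nhds.1 hp _
    ((aux _ continuous_fst).and (aux _ continuous_snd))
  exact hΩ q hqΩ _ hq.1 hq.2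

lemma IsCompleteReinhardt.norm_eq_one {Ω : Set (ℂ × ℂ)} (hΩ : IsCompleteReinhardt Ω)
    (hΩo : IsOpen Ω) {p : ℂ × ℂ} {l : ℂ} (hp : p ∈ frontier Ω) (hlp : l • p ∈ frontier Ω) :
    ‖l‖ = 1 := by
  rw [hΩo.frontier_eq] at hp hlp
  by_contra hne
  rcases lt_or_gt_of_ne hne with h | h
  · exact hlp.2 (hΩ.smul_mem hp.1 h)
  · have hl : l ≠ 0 := norm_pos_iff.1 (one_pos.trans h)
    refine hp.2 ?_
    rw [← inv_smul_smul₀ hl p]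
    exact hΩ.smul_mem hlp.1 (by rw [norm_inv]; exact inv_lt_one_of_one_lt₀ h)

lemma IsCompleteReinhardt.zero_notMem_frontier {Ω : Set (ℂ × ℂ)} (hΩ : IsCompleteReinhardt Ω)
    (hΩo : IsOpen Ω) : (0 : ℂ × ℂ) ∉ frontier Ω := by
  intro h
  have := hΩ.norm_eq_one hΩo (l := 0) h (by simpa using h)
  simp at this

lemma IsCompleteReinhardt.torusRotate_mem {Ω : Set (ℂ × ℂ)} (hΩ : IsCompleteReinhardt Ω)
    {p : ℂ × ℂ} (hp : p ∈ Ω) (t : UnitAddTorus (Fin 2)) : torusRotate t p ∈ Ω :=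
  hΩ p hp _ (norm_torusRotate_fst t p).le (norm_torusRotate_snd t p).le

lemma IsCompleteReinhardt.torusRotate_mem_frontier {Ω : Set (ℂ × ℂ)} (hΩ : IsCompleteReinhardt Ω)
    (hΩo : IsOpen Ω) {p : ℂ × ℂ} (hp : p ∈ frontier Ω) (t : UnitAddTorus (Fin 2)) :
    torusRotate t p ∈ frontier Ω := by
  rw [hΩo.frontier_eq] at hp ⊢
  refine ⟨map_mem_closure (f := torusRotate t)
    (continuous_torusRotate.comp (by fun_prop : Continuous fun p => (t, p))) hp.1
    fun q hq => hΩ.torusRotate_mem hq t, fun h => hp.2 ?_⟩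
  have := hΩ.torusRotate_mem h (-t)
  rwa [← torusRotate_add, neg_add_cancel, torusRotate_zero] at this

/-! ### Analytic disks in the boundary -/

namespace IsNontrivialBoundaryDisk

variable {Ω : Set (ℂ × ℂ)} {F : ℂ → ℂ × ℂ}

lemma mapsTo_closedBall (hF : IsNontrivialBoundaryDisk Ω F) :
    MapsTo F (Metric.closedBall 0 1) (frontier Ω) := by
  have h := hF.mapsTo_frontier.closure_of_continuousOn
    (by rw [closure_ball _ one_ne_zero]; exact hF.continuous_closedBall)
  rwa [closure_ball _ one_ne_zero, isClosed_frontier.closure_eq] at h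

lemma analyticOnNhd_fst (hF : IsNontrivialBoundaryDisk Ω F) :
    AnalyticOnNhd ℂ (fun ζ => (F ζ).1) (Metric.ball 0 1) :=
  hF.holomorphic.fst.analyticOnNhd Metric.isOpen_ball

lemma analyticOnNhd_snd (hF : IsNontrivialBoundaryDisk Ω F) :
    AnalyticOnNhd ℂ (fun ζ => (F ζ).2) (Metric.ball 0 1) :=
  hF.holomorphic.snd.analyticOnNhd Metric.isOpen_ball

/-- A non-trivial disk in the boundary is not contained in a complex line through the origin. -/
lemma not_eq_smul (hF : IsNontrivialBoundaryDisk Ω F) (hΩ : IsCompleteReinhardt Ω)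
    (hΩo : IsOpen Ω) {l : ℂ → ℂ} (hl : DifferentiableOn ℂ l (Metric.ball 0 1)) {p : ℂ × ℂ}
    (hp : p ∈ frontier Ω) : ¬ ∀ ζ ∈ Metric.ball (0 : ℂ) 1, F ζ = l ζ • p := by
  intro h
  have h1 : ∀ ζ ∈ Metric.ball (0 : ℂ) 1, ‖l ζ‖ = 1 := fun ζ hζ =>
    hΩ.norm_eq_one hΩo hp (h ζ hζ ▸ hF.mapsTo_frontier hζ)
  have h0 : (0 : ℂ) ∈ Metric.ball (0 : ℂ) 1 := by simp
  -- The modulus of `l` is constant, so the maximum principle makes `l`, and with it `F`, constant.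
  have hc := Complex.eqOn_of_isPreconnected_of_isMaxOn_norm
    (convex_ball (0 : ℂ) 1).isPreconnected Metric.isOpen_ball hl h0
    (fun ζ hζ => by simp [h1 ζ hζ, h1 0 h0])
  exact hF.nonconstant ⟨l 0 • p, fun ζ hζ => by rw [h ζ hζ, hc hζ]; rfl⟩

/-- Accumulating zeros would make the coordinate vanish identically and put the disk in a coordinate
axis, a line through the origin. -/
lemma eventually_fst_ne_zero (hF : IsNontrivialBoundaryDisk Ω F) (hΩ : IsCompleteReinhardt Ω)
    (hΩo : IsOpen Ω) {z : ℂ} (hz : z ∈ Metric.ball (0 : ℂ) 1) :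
    ∀ᶠ ζ in 𝓝[≠] z, (F ζ).1 ≠ 0 := by
  by_contra hcon
  have h := hF.analyticOnNhd_fst.eqOn_zero_of_preconnected_of_frequently_eq_zero
    (convex_ball (0 : ℂ) 1).isPreconnected hz hcon
  have hne : (F z).2 ≠ 0 := fun h2 => hΩ.zero_notMem_frontier hΩo <| by
    have := hF.mapsTo_frontier hz
    rwa [show F z = 0 from Prod.ext (h hz) h2] at this
  refine hF.not_eq_smul hΩ hΩo (l := fun ζ => (F ζ).2 / (F z).2) (hF.holomorphic.snd.div_const _)
    (hF.mapsTo_frontier hz) fun ζ hζ => Prod.ext ?_ ?_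
  · have h1 : (F ζ).1 = 0 := h hζ
    have h2 : (F z).1 = 0 := h hz
    simp [h1, h2]
  · simp [hne]

lemma eventually_snd_ne_zero (hF : IsNontrivialBoundaryDisk Ω F) (hΩ : IsCompleteReinhardt Ω)
    (hΩo : IsOpen Ω) {z : ℂ} (hz : z ∈ Metric.ball (0 : ℂ) 1) :
    ∀ᶠ ζ in 𝓝[≠] z, (F ζ).2 ≠ 0 := by
  by_contra hcon
  have h := hF.analyticOnNhd_snd.eqOn_zero_of_preconnected_of_frequently_eq_zero
    (convex_ball (0 : ℂ) 1).isPreconnected hz hcon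
  have hne : (F z).1 ≠ 0 := fun h2 => hΩ.zero_notMem_frontier hΩo <| by
    have := hF.mapsTo_frontier hz
    rwa [show F z = 0 from Prod.ext h2 (h hz)] at this
  refine hF.not_eq_smul hΩ hΩo (l := fun ζ => (F ζ).1 / (F z).1) (hF.holomorphic.fst.div_const _)
    (hF.mapsTo_frontier hz) fun ζ hζ => Prod.ext ?_ ?_
  · simp [hne]
  · have h1 : (F ζ).2 = 0 := h hζ
    have h2 : (F z).2 = 0 := h hz
    simp [h1, h2]

/-- Lets identities proved off the coordinate axes pass to the closed disk by continuity. -/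
lemma closedBall_subset_closure (hF : IsNontrivialBoundaryDisk Ω F) (hΩ : IsCompleteReinhardt Ω)
    (hΩo : IsOpen Ω) : Metric.closedBall (0 : ℂ) 1 ⊆
      closure {ζ ∈ Metric.ball (0 : ℂ) 1 | (F ζ).1 ≠ 0 ∧ (F ζ).2 ≠ 0} := by
  rw [← closure_ball _ one_ne_zero]
  refine closure_minimal (fun z hz => ?_) isClosed_closure
  have h : ∀ᶠ ζ in 𝓝[≠] z, ζ ∈ Metric.ball (0 : ℂ) 1 ∧ (F ζ).1 ≠ 0 ∧ (F ζ).2 ≠ 0 :=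
    (eventually_nhdsWithin_of_eventually_nhds (Metric.isOpen_ball.mem_nhds hz)).and
      ((hF.eventually_fst_ne_zero hΩ hΩo hz).and (hF.eventually_snd_ne_zero hΩ hΩo hz))
  exact mem_closure_iff_frequently.2 (h.frequently.filter_mono nhdsWithin_le_nhds)

/-- Points of the disk in the torus orbit of `F z` accumulate at `z`. -/
lemma frequently_eq_torusRotate (hF : IsNontrivialBoundaryDisk Ω F) (hΩ : IsCompleteReinhardt Ω)
    (hΩo : IsOpen Ω) {z : ℂ} (hz : z ∈ Metric.ball (0 : ℂ) 1) (h1 : (F z).1 ≠ 0)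
    (h2 : (F z).2 ≠ 0) :
    ∃ᶠ ζ in 𝓝[≠] z, ζ ∈ Metric.ball (0 : ℂ) 1 ∧ ∃ t, F ζ = torusRotate t (F z) := by
  set R : ℂ → ℂ := fun ζ => (F ζ).1 / (F ζ).2 with hRdef
  have hR : AnalyticAt ℂ R z := (hF.analyticOnNhd_fst z hz).div (hF.analyticOnNhd_snd z hz) h2
  have hRz : R z ≠ 0 := div_ne_zero h1 h2
  have hc2 : ContinuousAt (fun ζ => (F ζ).2) z := (hF.analyticOnNhd_snd z hz).continuousAt
  -- Open mapping theorem: a constant ratio would put the disk in the line through `F z`.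
  have hmap : 𝓝 (R z) ≤ map R (𝓝 z) := by
    refine hR.eventually_constant_or_nhds_le_map_nhds.resolve_left fun hconst => ?_
    have heq : EqOn (fun ζ => (F ζ).1) (fun ζ => R z * (F ζ).2) (Metric.ball 0 1) := by
      refine hF.analyticOnNhd_fst.eqOn_of_preconnected_of_eventuallyEq
        (analyticOnNhd_const.mul hF.analyticOnNhd_snd) (convex_ball (0 : ℂ) 1).isPreconnected hz ?_
      filter_upwards [hconst, hc2.eventually_ne h2] with ζ hζ hζ2
      rw [← hζ, hRdef, div_mul_cancel₀ _ hζ2]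
    refine hF.not_eq_smul hΩ hΩo (l := fun ζ => (F ζ).2 / (F z).2)
      (hF.holomorphic.snd.div_const _) (hF.mapsTo_frontier hz) fun ζ hζ => Prod.ext ?_ ?_
    · have := heq hζ
      simp only [hRdef] at this
      rw [this, Prod.smul_fst, smul_eq_mul]
      ring
    · simp [h2]
  rw [frequently_nhdsWithin_iff, frequently_iff]
  intro V hV
  have hV' : V ∩ (Metric.ball 0 1 ∩ {ζ | (F ζ).2 ≠ 0}) ∈ 𝓝 z :=
    inter_mem hV (inter_mem (Metric.isOpen_ball.mem_nhds hz) (hc2.eventually_ne h2))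
  have himage := hmap (image_mem_map hV')
  have hcont : Continuous fun γ : ℝ => ((Circle.exp γ : Circle) : ℂ) * R z := by fun_prop
  have h0 : Tendsto (fun γ : ℝ => ((Circle.exp γ : Circle) : ℂ) * R z) (𝓝[>] 0) (𝓝 (R z)) := by
    have := hcont.tendsto 0
    simp only [Circle.exp_zero, Circle.coe_one, one_mul] at this
    exact this.mono_left nhdsWithin_le_nhds
  -- Openness gives `ζ` near `z` with `R ζ = e^{iγ} R z` for some `0 < γ < 1`.
  obtain ⟨γ, ⟨ζ, ⟨hζV, hζ, hζ2⟩, hRζ⟩, hγ0, hγ1⟩ := ((h0.eventually himage).and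
    (Ioo_mem_nhdsGT (zero_lt_one (α := ℝ)))).exists
  have hF1 : (F ζ).1 = Circle.exp γ * R z * (F ζ).2 := by
    rw [← hRζ, hRdef, div_mul_cancel₀ _ hζ2]
  obtain ⟨s, hs⟩ : ∃ s : AddCircle (1 : ℝ), s.toCircle = Circle.exp γ :=
    AddCircle.surjective_toCircle _
  -- After the first coordinate of `F z` is rotated by `γ`, `F ζ` is a scalar multiple of it; both
  -- are boundary points, so the scalar is unimodular.
  have hsm : ‖(F ζ).2 / (F z).2‖ = 1 := by
    refine hΩ.norm_eq_one hΩo (hΩ.torusRotate_mem_frontier hΩo (hF.mapsTo_frontier hz)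
      ![s, 0]) (?_ : _ ∈ frontier Ω)
    convert hF.mapsTo_frontier hζ using 1
    refine Prod.ext ?_ ?_
    · simp [torusRotate, hs, hF1, hRdef]
      field_simp
    · simp [torusRotate, h2]
  obtain ⟨r, hr⟩ : ∃ r : AddCircle (1 : ℝ), r.toCircle = ⟨_, mem_sphere_zero_iff_norm.2 hsm⟩ :=
    AddCircle.surjective_toCircle _
  refine ⟨ζ, hζV, ⟨hζ, ![s + r, r], ?_⟩, ?_⟩
  · refine Prod.ext ?_ ?_
    · have hsr : ((s + r).toCircle : ℂ) = Circle.exp γ * ((F ζ).2 / (F z).2) := by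
        rw [AddCircle.toCircle_add, hs, hr]
        rfl
      change (F ζ).1 = ((s + r).toCircle : ℂ) * (F z).1
      rw [hsr, hF1]
      simp only [hRdef]
      field_simp
    · simp [torusRotate, hr, h2]
  · rintro rfl
    -- If `ζ = z`, then `γ` would be a multiple of `2π` inside `(0, 1)`.
    have : ((Circle.exp γ : Circle) : ℂ) = 1 := mul_right_cancel₀ hRz (by rw [← hRζ, one_mul])
    have h3 := Circle.exp_eq_one.1 (Circle.coe_eq_one.1 this)
    obtain ⟨m, hm⟩ := h3
    have hm0 : (0 : ℝ) < m := by
      by_contra hle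
      nlinarith [Real.pi_pos]
    have : (1 : ℝ) ≤ m := by exact_mod_cast (Int.cast_pos.1 hm0 : 0 < m)
    nlinarith [Real.pi_gt_three]

end IsNontrivialBoundaryDisk

/-! ### Homogeneous functions along a disk are Laurent monomials -/

namespace IsNontrivialBoundaryDisk

variable {Ω : Set (ℂ × ℂ)} {F : ℂ → ℂ × ℂ}

/-- Along a disk in the boundary, a holomorphic function that is homogeneous under the torus is a
Laurent monomial. -/
lemma exists_eq_const_mul_zpow (hF : IsNontrivialBoundaryDisk Ω F) (hΩ : IsCompleteReinhardt Ω)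
    (hΩo : IsOpen Ω) {G : ℂ → ℂ} (hG : DifferentiableOn ℂ G (Metric.ball 0 1)) (j k : ℤ)
    (hGF : ∀ ζ ξ t, F ξ = torusRotate t (F ζ) →
      G ξ = ((t 0).toCircle : ℂ) ^ j * ((t 1).toCircle : ℂ) ^ k * G ζ) :
    ∃ c : ℂ, ∀ ζ ∈ Metric.ball (0 : ℂ) 1, (F ζ).1 ≠ 0 → (F ζ).2 ≠ 0 →
      G ζ = c * ((F ζ).1 ^ j * (F ζ).2 ^ k) := by
  have h0 : (0 : ℂ) ∈ Metric.ball (0 : ℂ) 1 := by simp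
  obtain ⟨z, hz, hz1, hz2⟩ := closure_nonempty_iff.1
    ⟨0, hF.closedBall_subset_closure hΩ hΩo (Metric.ball_subset_closedBall h0)⟩
  have hsplit (x : ℂ) (hx : x ≠ 0) (m : ℤ) : x ^ m * x ^ (-m).toNat = x ^ m.toNat := by
    rw [← zpow_natCast, ← zpow_natCast, ← zpow_add₀ hx]
    congr 1
    omega
  set c := G z / ((F z).1 ^ j * (F z).2 ^ k) with hc
  -- Clearing negative exponents gives an identity between functions analytic on the whole disk,
  -- zeros of the coordinates included.
  have key (ζ : ℂ) (h1 : (F ζ).1 ≠ 0) (h2 : (F ζ).2 ≠ 0) :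
      G ζ = c * ((F ζ).1 ^ j * (F ζ).2 ^ k) ↔
      G ζ * ((F ζ).1 ^ (-j).toNat * (F ζ).2 ^ (-k).toNat) =
        c * ((F ζ).1 ^ j.toNat * (F ζ).2 ^ k.toNat) := by
    rw [← hsplit _ h1 j, ← hsplit _ h2 k,
      ← mul_left_inj' (mul_ne_zero (pow_ne_zero (-j).toNat h1) (pow_ne_zero (-k).toNat h2))]
    constructor <;> intro h <;> linear_combination h
  have hA1 := hF.analyticOnNhd_fst
  have hA2 := hF.analyticOnNhd_snd
  have heq : EqOn (fun ζ => G ζ * ((F ζ).1 ^ (-j).toNat * (F ζ).2 ^ (-k).toNat))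
      (fun ζ => c * ((F ζ).1 ^ j.toNat * (F ζ).2 ^ k.toNat)) (Metric.ball 0 1) := by
    refine ((hG.analyticOnNhd Metric.isOpen_ball).mul
      ((hA1.pow _).mul (hA2.pow _))).eqOn_of_preconnected_of_frequently_eq
      (analyticOnNhd_const.mul ((hA1.pow _).mul (hA2.pow _)))
      (convex_ball (0 : ℂ) 1).isPreconnected hz
      ((hF.frequently_eq_torusRotate hΩ hΩo hz hz1 hz2).mono ?_)
    rintro ζ ⟨-, t, ht⟩
    have e0 : ((t 0).toCircle : ℂ) ≠ 0 := Circle.coe_ne_zero _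
    have e1 : ((t 1).toCircle : ℂ) ≠ 0 := Circle.coe_ne_zero _
    refine (key ζ ?_ ?_).1 ?_
    · rw [ht]; exact mul_ne_zero e0 hz1
    · rw [ht]; exact mul_ne_zero e1 hz2
    · have h : c * ((F z).1 ^ j * (F z).2 ^ k) = G z :=
        div_mul_cancel₀ _ (mul_ne_zero (zpow_ne_zero _ hz1) (zpow_ne_zero _ hz2))
      rw [hGF z ζ t ht, ht, torusRotate, mul_zpow, mul_zpow, ← h]
      ring
  exact ⟨c, fun ζ hζ h1 h2 => (key ζ h1 h2).2 (heq hζ)⟩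

end IsNontrivialBoundaryDisk

/-! ### Smooth extension of Laurent monomials -/

lemma exists_contDiff_eq_inv {δ : ℝ} (hδ : 0 < δ) :
    ∃ s : ℂ → ℂ, ContDiff ℝ ∞ s ∧ ∀ z, δ ≤ ‖z‖ → s z = z⁻¹ := by
  -- The argument of the cutoff is negative near `0` and at least `1` once `‖z‖ ≥ δ`.
  refine ⟨fun z => Real.smoothTransition (2 / δ ^ 2 * ‖z‖ ^ 2 - 1) • z⁻¹, ?_, fun z hz => ?_⟩
  · rw [contDiff_iff_contDiffAt]
    intro z
    by_cases hz : z = 0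
    · refine (contDiffAt_const (c := (0 : ℂ))).congr_of_eventuallyEq ?_
      have hc : Continuous fun z : ℂ => 2 / δ ^ 2 * ‖z‖ ^ 2 - 1 := by fun_prop
      filter_upwards [(hc.tendsto z).eventually (eventually_lt_nhds (b := 0) (by simp [hz]))] with w hw
      rw [Real.smoothTransition.zero_of_nonpos hw.le, zero_smul]
    · have h1 : ContDiffAt ℝ ∞ (fun z : ℂ => Real.smoothTransition (2 / δ ^ 2 * ‖z‖ ^ 2 - 1)) z :=
        Real.smoothTransition.contDiff.contDiffAt.comp z
          ((contDiffAt_const.mul (contDiff_norm_sq ℝ).contDiffAt).sub contDiffAt_const)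
      exact h1.smul (contDiffAt_inv ℝ hz)
  · have : 1 ≤ 2 / δ ^ 2 * ‖z‖ ^ 2 - 1 := by
      have h1 : δ ^ 2 ≤ ‖z‖ ^ 2 := by gcongr
      have h2 : 2 ≤ 2 / δ ^ 2 * ‖z‖ ^ 2 := by
        rw [div_mul_eq_mul_div, le_div_iff₀ (by positivity)]
        linarith
      linarith
    simp only [Real.smoothTransition.one_of_one_le this, one_smul]

lemma exists_contDiff_eq_zpow {δ : ℝ} (hδ : 0 < δ) (j : ℤ) :
    ∃ P : ℂ → ℂ, ContDiff ℝ ∞ P ∧ ∀ z, 0 ≤ j ∨ δ ≤ ‖z‖ → P z = z ^ j := by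
  rcases le_or_gt 0 j with hj | hj
  · obtain ⟨n, rfl⟩ := Int.eq_ofNat_of_zero_le hj
    exact ⟨fun z => z ^ n, by fun_prop, fun z _ => by simp⟩
  · obtain ⟨n, hn⟩ := Int.eq_ofNat_of_zero_le (neg_nonneg.2 hj.le)
    obtain ⟨s, hs, hsz⟩ := exists_contDiff_eq_inv hδ
    refine ⟨fun z => s z ^ n, hs.pow n, fun z hz => ?_⟩
    beta_reduce
    rw [hsz z (hz.resolve_left hj.not_ge), ← neg_neg j, hn]
    simp

/-! ### Components on the torus orbit of a disk -/

/-- The torus orbit of the closed disk `F(𝔻̄)`. -/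
def torusOrbit (F : ℂ → ℂ × ℂ) : Set (ℂ × ℂ) :=
  (fun x : UnitAddTorus (Fin 2) × (ℂ × ℂ) => torusRotate x.1 x.2) ''
    (univ ×ˢ (F '' Metric.closedBall 0 1))

namespace IsNontrivialBoundaryDisk

variable {Ω : Set (ℂ × ℂ)} {F : ℂ → ℂ × ℂ}

lemma isCompact_torusOrbit (hF : IsNontrivialBoundaryDisk Ω F) : IsCompact (torusOrbit F) :=
  (isCompact_univ.prod ((isCompact_closedBall 0 1).image_of_continuousOn
    hF.continuous_closedBall)).image continuous_torusRotate

lemma exists_forall_le_norm {g : ℂ × ℂ → ℂ} (hg : Continuous g)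
    (hF : IsNontrivialBoundaryDisk Ω F) (h : ∀ ζ ∈ Metric.closedBall (0 : ℂ) 1, g (F ζ) ≠ 0) :
    ∃ δ > 0, ∀ ζ ∈ Metric.closedBall (0 : ℂ) 1, δ ≤ ‖g (F ζ)‖ := by
  obtain ⟨z, hz, hmin⟩ := (isCompact_closedBall (0 : ℂ) 1).exists_isMinOn ⟨0, by simp⟩
    (hg.comp_continuousOn hF.continuous_closedBall).norm
  exact ⟨_, norm_pos_iff.2 (h z hz), fun ζ hζ => hmin hζ⟩

/-- If a coordinate of `F` vanishes on the closed disk, then a continuous function which is a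
Laurent monomial with a pole in that coordinate vanishes. -/
lemma const_eq_zero (hF : IsNontrivialBoundaryDisk Ω F) (hΩ : IsCompleteReinhardt Ω)
    (hΩo : IsOpen Ω) {G : ℂ → ℂ} (hG : ContinuousOn G (Metric.closedBall 0 1)) {j k : ℤ} {c : ℂ}
    (hc : ∀ ζ ∈ Metric.ball (0 : ℂ) 1, (F ζ).1 ≠ 0 → (F ζ).2 ≠ 0 →
      G ζ = c * ((F ζ).1 ^ j * (F ζ).2 ^ k)) :
    (∀ z ∈ Metric.closedBall (0 : ℂ) 1, (F z).1 = 0 → j < 0 → c = 0) ∧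
    (∀ z ∈ Metric.closedBall (0 : ℂ) 1, (F z).2 = 0 → k < 0 → c = 0) := by
  have hF1 : ContinuousOn (fun ζ => (F ζ).1) (Metric.closedBall 0 1) := hF.continuous_closedBall.fst
  have hF2 : ContinuousOn (fun ζ => (F ζ).2) (Metric.closedBall 0 1) := hF.continuous_closedBall.snd
  set S := {ζ ∈ Metric.ball (0 : ℂ) 1 | (F ζ).1 ≠ 0 ∧ (F ζ).2 ≠ 0}
  have hS : S ⊆ Metric.closedBall 0 1 := fun ζ hζ => Metric.ball_subset_closedBall hζ.1
  have hpow (x : ℂ) (hx : x ≠ 0) {m : ℤ} (hm : m < 0) : x ^ (-m).toNat * x ^ m = 1 := by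
    rw [← zpow_natCast, ← zpow_add₀ hx, Int.toNat_of_nonneg (by omega), neg_add_cancel, zpow_zero]
  constructor
  · intro z hz hz1 hj
    have hz2 : (F z).2 ≠ 0 := fun h2 => hΩ.zero_notMem_frontier hΩo <| by
      have := hF.mapsTo_closedBall hz
      rwa [show F z = 0 from Prod.ext hz1 h2] at this
    have : (𝓝[S] z).NeBot := mem_closure_iff_nhdsWithin_neBot.1
      (hF.closedBall_subset_closure hΩ hΩo hz)
    -- Multiplying by the power that cancels the pole gives two limits at `z`: `0`, and `c` times a
    -- non-zero number.
    have h1 : Tendsto (fun ζ => G ζ * (F ζ).1 ^ (-j).toNat) (𝓝[S] z)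
        (𝓝 (G z * (F z).1 ^ (-j).toNat)) := ((hG.mul (hF1.pow _)) z hz).mono hS
    have h2 : Tendsto (fun ζ => c * (F ζ).2 ^ k) (𝓝[S] z) (𝓝 (c * (F z).2 ^ k)) :=
      (((hF2 z hz).mono hS).zpow₀ k (.inl hz2)).tendsto.const_mul c
    have h3 := tendsto_nhds_unique (h1.congr' ?_) h2
    · rw [hz1, zero_pow (by omega), mul_zero] at h3
      exact (mul_eq_zero.1 h3.symm).resolve_right (zpow_ne_zero _ hz2)
    · filter_upwards [self_mem_nhdsWithin] with ζ hζ
      rw [hc ζ hζ.1 hζ.2.1 hζ.2.2]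
      linear_combination (c * (F ζ).2 ^ k) * hpow _ hζ.2.1 hj
  · intro z hz hz2 hk
    have hz1 : (F z).1 ≠ 0 := fun h2 => hΩ.zero_notMem_frontier hΩo <| by
      have := hF.mapsTo_closedBall hz
      rwa [show F z = 0 from Prod.ext h2 hz2] at this
    have : (𝓝[S] z).NeBot := mem_closure_iff_nhdsWithin_neBot.1
      (hF.closedBall_subset_closure hΩ hΩo hz)
    have h1 : Tendsto (fun ζ => G ζ * (F ζ).2 ^ (-k).toNat) (𝓝[S] z)
        (𝓝 (G z * (F z).2 ^ (-k).toNat)) := ((hG.mul (hF2.pow _)) z hz).mono hS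
    have h2 : Tendsto (fun ζ => c * (F ζ).1 ^ j) (𝓝[S] z) (𝓝 (c * (F z).1 ^ j)) :=
      (((hF1 z hz).mono hS).zpow₀ j (.inl hz1)).tendsto.const_mul c
    have h3 := tendsto_nhds_unique (h1.congr' ?_) h2
    · rw [hz2, zero_pow (by omega), mul_zero] at h3
      exact (mul_eq_zero.1 h3.symm).resolve_right (zpow_ne_zero _ hz1)
    · filter_upwards [self_mem_nhdsWithin] with ζ hζ
      rw [hc ζ hζ.1 hζ.2.1 hζ.2.2]
      linear_combination (c * (F ζ).1 ^ j) * hpow _ hζ.2.2 hk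

/-- On the torus orbit of a disk in the boundary, each component of `φ` under the torus action is
the restriction of a smooth function that is holomorphic along all disks. -/
lemma exists_contDiff_eqOn_torusWeight (hF : IsNontrivialBoundaryDisk Ω F)
    (hΩ : IsCompleteReinhardt Ω) (hΩo : IsOpen Ω) {φ : ℂ × ℂ → ℂ} (hφ : Continuous φ)
    (hφ_hol : HolomorphicAlongDisks φ (frontier Ω)) (n : Fin 2 → ℤ) :
    ∃ Q : ℂ × ℂ → ℂ, ContDiff ℝ ∞ Q ∧ EqOn Q (torusWeight n φ) (torusOrbit F) ∧
      HolomorphicAlongDisks Q (torusOrbit F) := by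
  have hrot (t : UnitAddTorus (Fin 2)) : DifferentiableOn ℂ (fun ζ => torusRotate t (F ζ))
      (Metric.ball 0 1) :=
    (hF.holomorphic.fst.const_mul _).prodMk (hF.holomorphic.snd.const_mul _)
  have hdiff := differentiableOn_torusWeight_comp hφ Metric.isOpen_ball hF.holomorphic.continuousOn
    (fun t => hφ_hol _ (hrot t) fun ζ hζ =>
      hΩ.torusRotate_mem_frontier hΩo (hF.mapsTo_frontier hζ) t) n
  have hhom (t : UnitAddTorus (Fin 2)) (p : ℂ × ℂ) : torusWeight n φ (torusRotate t p) =
      ((t 0).toCircle : ℂ) ^ (-n 0) * ((t 1).toCircle : ℂ) ^ (-n 1) * torusWeight n φ p := by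
    rw [torusWeight_torusRotate, mFourier_apply_fin_two, Pi.neg_apply, Pi.neg_apply]
  generalize -n 0 = j at hhom
  generalize -n 1 = k at hhom
  obtain ⟨c, hc⟩ := hF.exists_eq_const_mul_zpow hΩ hΩo hdiff j k
    fun ζ ξ t h => by rw [h, hhom]
  have hcont : ContinuousOn (fun ζ => torusWeight n φ (F ζ)) (Metric.closedBall 0 1) :=
    (continuous_torusWeight hφ n).comp_continuousOn hF.continuous_closedBall
  obtain ⟨hz1, hz2⟩ := hF.const_eq_zero hΩ hΩo hcont hc
  have hF1 : ContinuousOn (fun ζ => (F ζ).1) (Metric.closedBall 0 1) := hF.continuous_closedBall.fst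
  have hF2 : ContinuousOn (fun ζ => (F ζ).2) (Metric.closedBall 0 1) := hF.continuous_closedBall.snd
  have hS : {ζ ∈ Metric.ball (0 : ℂ) 1 | (F ζ).1 ≠ 0 ∧ (F ζ).2 ≠ 0} ⊆ Metric.closedBall 0 1 :=
    fun ζ hζ => Metric.ball_subset_closedBall hζ.1
  have hdense := hF.closedBall_subset_closure hΩ hΩo
  by_cases hc0 : c = 0
  · refine ⟨0, contDiff_const, ?_, fun f _ _ => differentiableOn_const 0⟩
    have h0 : EqOn (fun ζ => torusWeight n φ (F ζ)) (fun _ => 0) (Metric.closedBall 0 1) :=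
      EqOn.of_subset_closure (fun ζ hζ => by simp only [hc ζ hζ.1 hζ.2.1 hζ.2.2, hc0, zero_mul])
        hcont continuousOn_const hS hdense
    rintro _ ⟨⟨t, _⟩, ⟨-, ζ, hζ, rfl⟩, rfl⟩
    have h1 : torusWeight n φ (F ζ) = 0 := h0 hζ
    simp only [hhom, h1, mul_zero, Pi.zero_apply]
  -- A zero of the coordinate with a negative exponent would force `c = 0`; compactness then yields
  -- the lower bound.
  have hδ1 : ∃ δ > 0, ∀ ζ ∈ Metric.closedBall (0 : ℂ) 1, 0 ≤ j ∨ δ ≤ ‖(F ζ).1‖ := by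
    by_cases hj : 0 ≤ j
    · exact ⟨1, one_pos, fun _ _ => .inl hj⟩
    · obtain ⟨δ, hδ, h⟩ := hF.exists_forall_le_norm continuous_fst
        fun ζ hζ h => hc0 (hz1 ζ hζ h (not_le.1 hj))
      exact ⟨δ, hδ, fun ζ hζ => .inr (h ζ hζ)⟩
  have hδ2 : ∃ δ > 0, ∀ ζ ∈ Metric.closedBall (0 : ℂ) 1, 0 ≤ k ∨ δ ≤ ‖(F ζ).2‖ := by
    by_cases hk : 0 ≤ k
    · exact ⟨1, one_pos, fun _ _ => .inl hk⟩
    · obtain ⟨δ, hδ, h⟩ := hF.exists_forall_le_norm continuous_snd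
        fun ζ hζ h => hc0 (hz2 ζ hζ h (not_le.1 hk))
      exact ⟨δ, hδ, fun ζ hζ => .inr (h ζ hζ)⟩
  obtain ⟨δ1, hδ1, h1⟩ := hδ1
  obtain ⟨δ2, hδ2, h2⟩ := hδ2
  obtain ⟨P1, hP1, hP1z⟩ := exists_contDiff_eq_zpow hδ1 j
  obtain ⟨P2, hP2, hP2z⟩ := exists_contDiff_eq_zpow hδ2 k
  have hor1 : ∀ p ∈ torusOrbit F, 0 ≤ j ∨ δ1 ≤ ‖p.1‖ := by
    rintro _ ⟨⟨t, _⟩, ⟨-, ζ, hζ, rfl⟩, rfl⟩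
    rw [norm_torusRotate_fst]
    exact h1 ζ hζ
  have hor2 : ∀ p ∈ torusOrbit F, 0 ≤ k ∨ δ2 ≤ ‖p.2‖ := by
    rintro _ ⟨⟨t, _⟩, ⟨-, ζ, hζ, rfl⟩, rfl⟩
    rw [norm_torusRotate_snd]
    exact h2 ζ hζ
  have hne {m : ℤ} {δ : ℝ} (hδ : 0 < δ) {x : ℂ} (h : 0 ≤ m ∨ δ ≤ ‖x‖) : x ≠ 0 ∨ 0 ≤ m :=
    h.symm.imp_left fun h => norm_pos_iff.1 (hδ.trans_le h)
  refine ⟨fun p => c * (P1 p.1 * P2 p.2), contDiff_const.mul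
    ((hP1.comp contDiff_fst).mul (hP2.comp contDiff_snd)), ?_, fun f hf hfS => ?_⟩
  · have h0 : EqOn (fun ζ => torusWeight n φ (F ζ)) (fun ζ => c * ((F ζ).1 ^ j * (F ζ).2 ^ k))
        (Metric.closedBall 0 1) := by
      refine EqOn.of_subset_closure (fun ζ hζ => hc ζ hζ.1 hζ.2.1 hζ.2.2) hcont ?_ hS hdense
      exact continuousOn_const.mul ((hF1.zpow₀ j fun ζ hζ => hne hδ1 (h1 ζ hζ)).mul
        (hF2.zpow₀ k fun ζ hζ => hne hδ2 (h2 ζ hζ)))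
    rintro p hp
    have e1 := hP1z _ (hor1 p hp)
    have e2 := hP2z _ (hor2 p hp)
    obtain ⟨⟨t, _⟩, ⟨-, ζ, hζ, rfl⟩, rfl⟩ := hp
    have e0 : torusWeight n φ (F ζ) = _ := h0 hζ
    simp only [e1, e2, hhom, e0]
    rw [torusRotate, mul_zpow, mul_zpow]
    ring
  · have hmono : DifferentiableOn ℂ (fun ζ => c * ((f ζ).1 ^ j * (f ζ).2 ^ k))
        (Metric.ball 0 1) := fun ζ hζ =>
      (((hf.fst ζ hζ).zpow (hne hδ1 (hor1 _ (hfS hζ)))).mul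
        ((hf.snd ζ hζ).zpow (hne hδ2 (hor2 _ (hfS hζ))))).const_mul c
    refine hmono.congr fun ζ hζ => ?_
    simp only [Function.comp_apply, hP1z _ (hor1 _ (hfS hζ)), hP2z _ (hor2 _ (hfS hζ))]

end IsNontrivialBoundaryDisk

/-! ### Assembling the approximating sequence -/

lemma diskFamily_subset_torusOrbit (F : ℂ → ℂ × ℂ) : diskFamily F ⊆ torusOrbit F := by
  rintro _ ⟨θ, -, ζ, hζ, rfl⟩
  obtain ⟨s, hs⟩ := AddCircle.surjective_toCircle (Circle.exp θ)
  refine ⟨(![s, s], F ζ), ⟨mem_univ _, ζ, Metric.ball_subset_closedBall hζ, rfl⟩, ?_⟩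
  simp [torusRotate, hs]

theorem mainTheorem3 (Ω : Set (ℂ × ℂ)) (hΩ : IsSmoothPseudoconvexReinhardtDomain Ω)
    (φ : ℂ × ℂ → ℂ) (hφ : ContinuousOn φ (closure Ω))
    (hφ_hol : HolomorphicAlongDisks φ (frontier Ω))
    (Γ : Set (ℂ × ℂ)) (hΓ : IsContinuousDiskFamily Ω Γ) (hΓ_iso : IsIsolatedDiskFamily Ω Γ) :
    ∃ ψ : ℕ → ℂ × ℂ → ℂ,
      (∀ n, ContDiff ℝ ∞ (ψ n)) ∧
      TendstoUniformlyOn ψ φ Filter.atTop (closure Γ) ∧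
      ∀ n, HolomorphicAlongDisks (ψ n) Γ := by
  obtain ⟨F, hF, rfl⟩ := hΓ
  have hR := hΩ.completeReinhardt
  have hΩo := hΩ.isOpen
  -- Tietze extension; the torus orbit of the disk stays in `closure Ω`, where `Φ = φ`.
  obtain ⟨Φ, hΦ⟩ := ContinuousMap.exists_restrict_eq isClosed_closure
    (⟨(closure Ω).domRestrict φ, hφ.domRestrict⟩ : C(closure Ω, ℂ))
  have hΦφ : EqOn Φ φ (closure Ω) := fun p hp => congrArg (fun g => g ⟨p, hp⟩) hΦ
  have hΦ_hol : HolomorphicAlongDisks Φ (frontier Ω) := fun f hf hfS =>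
    (hφ_hol f hf hfS).congr fun ζ hζ => hΦφ (frontier_subset_closure (hfS hζ))
  have horbit : torusOrbit F ⊆ closure Ω := by
    rintro _ ⟨⟨t, _⟩, ⟨-, ζ, hζ, rfl⟩, rfl⟩
    exact frontier_subset_closure (hR.torusRotate_mem_frontier hΩo (hF.mapsTo_closedBall hζ) t)
  have hΓ := closure_minimal (diskFamily_subset_torusOrbit F) hF.isCompact_torusOrbit.isClosed
  choose Q hQ hQeq hQhol using hF.exists_contDiff_eqOn_torusWeight hR hΩo Φ.continuous hΦ_hol
  choose a ha using fun n : ℕ => exists_sum_torusWeight_near Φ.continuous hF.isCompact_torusOrbit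
    (Nat.one_div_pos_of_nat (α := ℝ) (n := n))
  refine ⟨fun n p => ∑ m ∈ (a n).support, a n m * Q m p,
    fun n => ContDiff.sum fun m _ => contDiff_const.mul (hQ m), ?_, fun n f hf hfS => ?_⟩
  · rw [Metric.tendstoUniformlyOn_iff]
    intro ε hε
    obtain ⟨N, hN⟩ := exists_nat_one_div_lt hε
    filter_upwards [eventually_ge_atTop N] with n hn p hp
    have hp' := hΓ hp
    have hsum : ∑ m ∈ (a n).support, a n m * Q m p = (a n).sum fun m c => c * torusWeight m Φ p :=
      Finset.sum_congr rfl fun m _ => by rw [hQeq m hp']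
    rw [dist_eq_norm, hsum, ← hΦφ (horbit hp')]
    exact (ha n p hp').trans ((Nat.one_div_le_one_div hn).trans_lt hN)
  · exact DifferentiableOn.fun_sum fun m _ => (hQhol m f hf fun ζ hζ =>
      diskFamily_subset_torusOrbit F (hfS hζ)).const_mul _
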